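/- Let $n\ge 1$. Functions and distributions are complex-valued. For $r\in\mathbb R$ put $H^r(\mathbb R^n)=\{u\in\mathscr S'(\mathbb R^n):\mathcal F^{-1}(\langle\cdot\rangle^r\hat u)\in L^2(\mathbb R^n)\}$ with $\|u\|_{H^r}=\|\mathcal F^{-1}(\langle\cdot\rangle^r\hat u)\|_{L^2}$, where $\langle x\rangle=(1+|x|^2)^{1/2}$. For an open set $\Omega\subset\mathbb R^n$ and a closed set $F\subset\mathbb R^n$ let $H^r_F(\mathbb R^n)=\{u\in H^r(\mathbb R^n):\operatorname{spt}u\subset F\}$, let $\widetilde H^r(\Omega)$ be the closure of $C_c^\infty(\Omega)$ in $H^r(\mathbb R^n)$, let $H^r(\Omega)=\{u|_\Omega:u\in H^r(\mathbb R^n)\}$ with the quotient norm, and let $H^r_0(\Omega)$ be the closure of $C_c^\infty(\Omega)$ in $H^r(\Omega)$. For $r,t\in\mathbb R$, $M(H^r\to H^t)$ is the space of distributions $f\in\mathcal D'(\mathbb R^n)$ for which $$\|f\|_{r,t}=\sup\{|\langle f,uv\rangle| : u,v\in C_c^\infty(\mathbb R^n),\ \|u\|_{H^r}=\|v\|_{H^{-t}}=1\}$$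 is finite, and $M_0(H^r\to H^t)$ is the closure of $C_c^\infty(\mathbb R^n)$ in $M(H^r\to H^t)$ with respect to this norm. A Lipschitz domain is an open set $\Omega$ with compact boundary that is covered by finitely many open sets $W_j$ such that $W_j\cap\Omega=W_j\cap\Omega_j$, where each $\Omega_j$ is, up to a rigid motion, of the form $\{x: x_n<\zeta_j(x_1,\dots,x_{n-1})\}$ with $\zeta_j$ Lipschitz. **Proposition.** Let $\Omega\subset\mathbb R^n$ be open and $t>0$. Functions on $\Omega$ are identified with their extensions by zero to $\mathbb R^n$. (i) $L^p(\Omega)\subset M_0(H^0\to H^{-t})$ whenever $2\le p<\infty$ and $p>n/t$. In particular, if $\Omega$ is bounded, then $L^\infty(\Omega)\subset M_0(H^0\to H^{-t})$. (ii) Let $r\ge 0$ and $r>n/2-t$. Then $\widetilde H^r(\Omega)\subset M_0(H^0\to H^{-t})$. If $\Omega$ is a Lipschitz domain, then also $H^r_{\overline\Omega}(\mathbb R^n)\subset M_0(H^0\to H^{-t})$. If $\Omega$ is a Lipschitz domain and $r\notin\{\tfrac12,\tfrac32,\tfrac52,\dots\}$, then also $H^r_0(\Omega)\subset M_0(H^0\to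 H^{-t})$; that is, every element of $H^r_0(\Omega)$ is given by a function in $L^2(\Omega)$, and the extension by zero of that function belongs to $M_0(H^0\to H^{-t})$. -/

import Mathlib

open MeasureTheory TopologicalSpace
open scoped ENNReal NNReal SchwartzMap Distributions ContDiff

namespace SobolevMultipliers

noncomputable section

/-- `ℝⁿ` with its Euclidean norm. -/
abbrev Rn (n : ℕ) : Type := EuclideanSpace ℝ (Fin n)

/-- `𝒟'(Ω)`: the complex distributions on the open set `Ω`, that is, the continuous linear
functionals on `C_c^∞(Ω)` (complex-valued test functions with their usual LF topology). -/
abbrev Distrib {n : ℕ} (Ω : Opens (Rn n)) : Type := 𝓓(Ω, ℂ) →L[ℂ] ℂ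

/-- A test function on `Ω`, extended by zero, as a Schwartz function on `ℝⁿ`. -/
def toSchwartz {n : ℕ} {Ω : Opens (Rn n)} (φ : 𝓓(Ω, ℂ)) : 𝓢(Rn n, ℂ) :=
  φ.hasCompactSupport.toSchwartzMap φ.contDiff

@[simp]
theorem toSchwartz_apply {n : ℕ} {Ω : Opens (Rn n)} (φ : 𝓓(Ω, ℂ)) (x : Rn n) :
    toSchwartz φ x = φ x := rfl

/-- The inclusion `C_c^∞(K) ⊆ 𝓢(ℝⁿ)` is continuous for every compact `K`. -/
theorem continuous_toSchwartz_comp_ofSupportedIn {n : ℕ} {Ω : Opens (Rn n)}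
    (K : Compacts (Rn n)) (hK : (K : Set (Rn n)) ⊆ Ω) :
    Continuous (toSchwartz ∘ TestFunction.ofSupportedIn hK : 𝓓_{K}(Rn n, ℂ) → 𝓢(Rn n, ℂ)) := by
  let L : 𝓓_{K}(Rn n, ℂ) →ₗ[ℝ] 𝓢(Rn n, ℂ) :=
    { toFun := toSchwartz ∘ TestFunction.ofSupportedIn hK
      map_add' := fun f g => by ext x; rfl
      map_smul' := fun c f => by ext x; rfl }
  change Continuous L
  refine WithSeminorms.continuous_of_isBounded
    (ContDiffMapSupportedIn.withSeminorms ℝ (Rn n) ℂ ⊤ K)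
    (schwartz_withSeminorms ℝ (Rn n) ℂ) L ?_
  rintro ⟨k, l⟩
  obtain ⟨R, hR⟩ := K.isCompact.isBounded.exists_norm_le
  refine ⟨{l}, ⟨(max R 0) ^ k, by positivity⟩, fun f => ?_⟩
  simp only [Finset.sup_singleton]
  refine SchwartzMap.seminorm_le_bound ℝ k l _ ?_ ?_
  · exact apply_nonneg _ _
  · intro x
    change ‖x‖ ^ k * ‖iteratedFDeriv ℝ l (f : Rn n → ℂ) x‖ ≤ (max R 0) ^ k * _
    by_cases hx : x ∈ K
    · have h1 : ‖x‖ ≤ max R 0 := (hR x hx).trans (le_max_left _ _)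
      have h2 := ContDiffMapSupportedIn.norm_iteratedFDeriv_apply_le_seminorm_top ℝ
        (f := f) (i := l) (x := x)
      gcongr
    · have h0 : iteratedFDeriv ℝ l (f : Rn n → ℂ) x = 0 := f.iteratedFDeriv_zero_on_compl hx
      rw [h0, norm_zero, mul_zero]
      exact mul_nonneg (by positivity) (apply_nonneg _ _)

/-- The continuous inclusion `C_c^∞(Ω) ⊆ 𝓢(ℝⁿ)`. -/
def toSchwartzCLM {n : ℕ} (Ω : Opens (Rn n)) : 𝓓(Ω, ℂ) →L[ℂ] 𝓢(Rn n, ℂ) :=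
  TestFunction.mkCLM ℂ toSchwartz (fun _ _ => rfl) (fun _ _ => rfl)
    (fun K hK => continuous_toSchwartz_comp_ofSupportedIn K hK)

/-- The restriction `U|_Ω ∈ 𝒟'(Ω)` of a tempered distribution `U`. -/
def restrict {n : ℕ} (Ω : Opens (Rn n)) (U : 𝓢'(Rn n, ℂ)) : Distrib Ω where
  toFun φ := U (toSchwartzCLM Ω φ)
  map_add' φ ψ := by simp
  map_smul' c φ := by simp
  cont := (ContinuousLinearMap.continuous _).comp (toSchwartzCLM Ω).continuous

/-- The distribution `φ ↦ ∫ φ g dx` on `Ω` of a function `g` that is locally integrable on `Ω`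
(and, by convention, `0` for other `g`). -/
def ofFun {n : ℕ} (Ω : Opens (Rn n)) (g : Rn n → ℂ) : Distrib Ω :=
  TestFunction.integralAgainstBilinCLM (ContinuousLinearMap.mul ℂ ℂ) volume g

/-- A test function, extended by zero, as a tempered distribution on `ℝⁿ`. -/
def testToTempered {n : ℕ} {Ω : Opens (Rn n)} (φ : 𝓓(Ω, ℂ)) : 𝓢'(Rn n, ℂ) :=
  SchwartzMap.toTemperedDistributionCLM (Rn n) ℂ volume (toSchwartz φ)

/-- The pointwise product of two test functions. -/
def testMul {n : ℕ} {Ω : Opens (Rn n)} (u v : 𝓓(Ω, ℂ)) : 𝓓(Ω, ℂ) where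
  toFun x := u x * v x
  contDiff' := u.contDiff.mul v.contDiff
  hasCompactSupport' := u.hasCompactSupport.mul_right
  tsupport_subset' := (tsupport_mul_subset_left (f := u) (g := v)).trans u.tsupport_subset

/-- The norm `‖U‖_{H^r(ℝⁿ)} = ‖𝓕⁻¹(⟨·⟩^r 𝓕 U)‖_{L²(ℝⁿ)}` of a tempered distribution, with value
`∞` if `U ∉ H^r(ℝⁿ)`. (The infimum is over the at most one `g ∈ L²` that represents
`𝓕⁻¹(⟨·⟩^r 𝓕 U)`.) -/
def sobolevNorm {n : ℕ} (r : ℝ) (U : 𝓢'(Rn n, ℂ)) : ℝ≥0∞ :=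
  ⨅ (g : Lp ℂ 2 (volume : Measure (Rn n)))
    (_ : TemperedDistribution.besselPotential (Rn n) ℂ r U = g), ‖g‖ₑ

/-- The quotient norm of `H^r(Ω) = {U|_Ω : U ∈ H^r(ℝⁿ)}`, with value `∞` outside `H^r(Ω)`. -/
def localSobolevNorm {n : ℕ} (r : ℝ) {Ω : Opens (Rn n)} (w : Distrib Ω) : ℝ≥0∞ :=
  ⨅ (U : 𝓢'(Rn n, ℂ)) (_ : restrict Ω U = w), sobolevNorm r U

/-- `H^r_F(ℝⁿ)`: the elements of `H^r(ℝⁿ)` whose support lies in `F`. -/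
def sobolevSupportedIn {n : ℕ} (r : ℝ) (F : Set (Rn n)) : Set 𝓢'(Rn n, ℂ) :=
  {U | TemperedDistribution.MemSobolev r 2 U ∧ Distribution.dsupport U ⊆ F}

/-- `H̃^r(Ω)`: the closure of `C_c^∞(Ω)` in `H^r(ℝⁿ)`. -/
def tildeSobolev {n : ℕ} (r : ℝ) (Ω : Opens (Rn n)) : Set 𝓢'(Rn n, ℂ) :=
  {U | TemperedDistribution.MemSobolev r 2 U ∧
    ∀ ε : ℝ≥0∞, 0 < ε → ∃ φ : 𝓓(Ω, ℂ), sobolevNorm r (U - testToTempered φ) < ε}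

/-- `H^r_0(Ω)`: the closure of `C_c^∞(Ω)` in `H^r(Ω)`. -/
def sobolevZero {n : ℕ} (r : ℝ) (Ω : Opens (Rn n)) : Set (Distrib Ω) :=
  {w | localSobolevNorm r w < ⊤ ∧
    ∀ ε : ℝ≥0∞, 0 < ε → ∃ φ : 𝓓(Ω, ℂ), localSobolevNorm r (w - ofFun Ω φ) < ε}

/-- The multiplier norm `‖f‖_{r,t}`: the supremum of `|⟨f, uv⟩|` over `u, v ∈ C_c^∞(ℝⁿ)` with
`‖u‖_{H^r} = ‖v‖_{H^{-t}} = 1`. -/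
def multiplierNorm {n : ℕ} (r t : ℝ) (f : Distrib (⊤ : Opens (Rn n))) : ℝ≥0∞ :=
  ⨆ (u : 𝓓((⊤ : Opens (Rn n)), ℂ)) (v : 𝓓((⊤ : Opens (Rn n)), ℂ))
    (_ : sobolevNorm r (testToTempered u) = 1) (_ : sobolevNorm (-t) (testToTempered v) = 1),
    ‖f (testMul u v)‖ₑ

/-- `M(H^r → H^t)`: the distributions on `ℝⁿ` of finite multiplier norm. -/
def multipliers (n : ℕ) (r t : ℝ) : Set (Distrib (⊤ : Opens (Rn n))) :=
  {f | multiplierNorm r t f < ⊤}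

/-- `M₀(H^r → H^t)`: the elements of `M(H^r → H^t)` that are limits, in the multiplier norm, of
functions in `C_c^∞(ℝⁿ)`. -/
def multipliersZero (n : ℕ) (r t : ℝ) : Set (Distrib (⊤ : Opens (Rn n))) :=
  {f | f ∈ multipliers n r t ∧ ∀ ε : ℝ≥0∞, 0 < ε →
    ∃ φ : 𝓓((⊤ : Opens (Rn n)), ℂ), multiplierNorm r t (f - ofFun ⊤ φ) < ε}

/-- A Lipschitz hypograph up to a rigid motion: in some orthonormal coordinates `(x', xₙ)`, with
`xₙ` the coordinate along the unit vector `e`, the set `{xₙ < ζ(x')}` with `ζ` Lipschitz. -/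
def IsLipschitzHypograph {n : ℕ} (G : Set (Rn n)) : Prop :=
  ∃ (e : Rn n) (ζ : Rn n → ℝ) (K : ℝ≥0), ‖e‖ = 1 ∧ LipschitzWith K ζ ∧
    G = {x | inner ℝ e x < ζ (x - inner ℝ e x • e)}

/-- Lipschitz domains: open sets with compact boundary that is covered by finitely many open sets
`W j`, in each of which `Ω` coincides with a Lipschitz hypograph `G j` up to a rigid motion. -/
def IsLipschitzDomain {n : ℕ} (Ω : Opens (Rn n)) : Prop :=
  IsCompact (frontier (Ω : Set (Rn n))) ∧
    ∃ (N : ℕ) (W G : Fin N → Set (Rn n)),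
      (∀ j, IsOpen (W j)) ∧ frontier (Ω : Set (Rn n)) ⊆ ⋃ j, W j ∧
      ∀ j, IsLipschitzHypograph (G j) ∧ W j ∩ (Ω : Set (Rn n)) = W j ∩ G j

end

end SobolevMultipliers

open SobolevMultipliers

/-! On a product `u v`, three-factor Hölder with 1/2 + 1/q + 1/p = 1 gives |∫ f u v| ≤ ‖u‖₂ ‖v‖_q
‖f‖_p. The Sobolev embedding H^t ⊆ L^q holds because n(1/2 - 1/q) = n/p < t. Hence the multiplier
norm is at most a constant times ‖f‖_p (`exists_multiplierNorm_ofFun_le`), and density of C_c^∞ in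
L^p for finite p puts L^p into M₀ (`ofFun_mem_multipliersZero`).

For (ii), the same embedding places H^r in some admissible L^p (`exists_memLp_of_memSobolev`). For
H^r_0(Ω), an element is extended to some function in H^r(ℝⁿ), which is then cut off to Ω. The
cut-off need not preserve Sobolev regularity, only membership in L^p.

The embedding itself (`exists_eLpNorm_le_of_besselPotential_eq`) is proved by dyadic decomposition
in frequency: Bernstein's inequality bounds each piece, and the strict inequality on s makes the
bounds a convergent geometric series. -/

section

open FourierTransform Filter Topology

/-! ### The inverse Fourier transform from L¹ ∩ L² to L^∞ -/

section Fourier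

variable {E : Type*} [NormedAddCommGroup E] [InnerProductSpace ℝ E] [FiniteDimensional ℝ E]
  [MeasurableSpace E] [BorelSpace E]

/-- Fubini, with the symmetry of the kernel in its two variables. -/
theorem integral_fourierInv_smul_eq_of_integrable {f g : E → ℂ} (hf : Integrable f)
    (hg : Integrable g) : ∫ x, 𝓕⁻ f x • g x = ∫ x, f x • 𝓕⁻ g x := by
  have h := VectorFourier.integral_fourierIntegral_smul_eq_flip (L := -innerₗ E) (μ := volume)
    (ν := volume) (f := f) (g := g) Real.continuous_fourierChar
    (by simp only [LinearMap.neg_apply]; exact continuous_inner.neg) hf hg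
  have hflip : (-innerₗ E).flip = -innerₗ E := by
    ext x y
    simp [real_inner_comm]
  rw [hflip] at h
  exact h

/-- The `L²` inverse Fourier transform agrees with the integral formula on `L¹ ∩ L²`. -/
theorem coeFn_fourierInv_ae_eq (F : Lp ℂ 2 (volume : Measure E)) (hF : Integrable F) :
    (𝓕⁻ F : Lp ℂ 2 (volume : Measure E)) =ᵐ[volume] 𝓕⁻ (F : E → ℂ) := by
  have hcont : Continuous (𝓕⁻ (F : E → ℂ)) :=
    VectorFourier.fourierIntegral_continuous Real.continuous_fourierChar
      (by simp only [LinearMap.neg_apply]; exact continuous_inner.neg) hF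
  -- Both sides are locally integrable, so it suffices to compare them as distributions, on real
  -- test functions.
  refine ae_eq_of_integral_contDiff_smul_eq
    ((Lp.memLp _).locallyIntegrable (by norm_num)) hcont.locallyIntegrable ?_
  intro g hg hgc
  have hg₁ : HasCompactSupport (Complex.ofRealCLM ∘ g) := hgc.comp_left rfl
  have hg₂ : ContDiff ℝ ∞ (Complex.ofRealCLM ∘ g) := by fun_prop
  let φ : 𝓢(E, ℂ) := hg₁.toSchwartzMap hg₂
  have h1 := congrArg (fun T : 𝓢'(E, ℂ) => T φ) (Lp.fourierInv_toTemperedDistribution_eq F)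
  simp only [TemperedDistribution.fourierInv_apply, Lp.toTemperedDistribution_apply] at h1
  have h2 := integral_fourierInv_smul_eq_of_integrable (φ.integrable (μ := volume)) hF
  have h3 : ∫ x, (𝓕⁻ φ) x • F x = ∫ x, φ x • 𝓕⁻ (F : E → ℂ) x := by
    rw [← h2]; rw [SchwartzMap.fourierInv_coe]
  rw [h3] at h1
  have h4 : ∀ x, φ x = (g x : ℂ) := fun x => rfl
  simp only [h4] at h1
  simpa using h1.symm

theorem eLpNorm_top_fourierInv_le (F : Lp ℂ 2 (volume : Measure E)) :
    eLpNorm (𝓕⁻ F : Lp ℂ 2 (volume : Measure E)) ⊤ volume ≤ eLpNorm F 1 volume := by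
  by_cases hF : Integrable F
  · rw [eLpNorm_congr_ae (coeFn_fourierInv_ae_eq F hF), eLpNorm_exponent_top]
    refine essSup_le_of_ae_le _ (.of_forall fun x => ?_)
    rw [eLpNorm_one_eq_lintegral_enorm]
    change ‖𝓕⁻ (F : E → ℂ) x‖ₑ ≤ ∫⁻ v, ‖F v‖ₑ
    rw [Real.fourierInv_eq]
    refine (enorm_integral_le_lintegral_enorm _).trans (le_of_eq ?_)
    refine lintegral_congr fun v => ?_
    rw [← ofReal_norm, ← ofReal_norm, Circle.norm_smul]
  · have : eLpNorm F 1 volume = ⊤ := by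
      by_contra h
      exact hF (memLp_one_iff_integrable.1 ⟨(Lp.memLp F).1, lt_top_iff_ne_top.2 h⟩)
    rw [this]; exact le_top

end Fourier

/-- Interpolation of `L^q` between `L²` and `L^∞`. -/
theorem eLpNorm_le_two_top {α : Type*} [MeasurableSpace α] {μ : Measure α} {f : α → ℂ}
    {q : ℝ≥0∞} (hf : AEStronglyMeasurable f μ) (hq : 2 ≤ q) :
    eLpNorm f q μ ≤ eLpNorm f ⊤ μ ^ (1 - 2 / q.toReal) * eLpNorm f 2 μ ^ (2 / q.toReal) := by
  -- For q = ∞, `q.toReal = 0` and 2/0 = 0, so the exponents are 1 and 0, as they should be.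
  rcases eq_or_ne q ⊤ with rfl | hqt
  · simp
  have hq2 : 2 ≤ q.toReal := by
    have := ENNReal.toReal_mono hqt hq
    simpa using this
  have hq0 : q ≠ 0 := by intro h; rw [h, ENNReal.toReal_zero] at hq2; linarith
  set M := eLpNorm f ⊤ μ with hM
  rw [eLpNorm_eq_lintegral_rpow_enorm_toReal hq0 hqt,
    eLpNorm_eq_lintegral_rpow_enorm_toReal (p := 2) (by norm_num) (by norm_num)]
  have h1 : ∫⁻ x, ‖f x‖ₑ ^ q.toReal ∂μ ≤ M ^ (q.toReal - 2) * ∫⁻ x, ‖f x‖ₑ ^ (2 : ℝ) ∂μ := by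
    rw [← lintegral_const_mul'' _ (hf.enorm.pow_const _)]
    refine lintegral_mono_ae ?_
    filter_upwards [ae_le_eLpNormEssSup (f := f) (μ := μ)] with x hx
    have : ‖f x‖ₑ ^ q.toReal = ‖f x‖ₑ ^ (q.toReal - 2) * ‖f x‖ₑ ^ (2 : ℝ) := by
      rw [← ENNReal.rpow_add_of_nonneg _ _ (by linarith) (by norm_num)]; congr 1; ring
    rw [this]
    rw [hM, eLpNorm_exponent_top]
    gcongr
  have hpos : 0 < q.toReal := by linarith
  calc _ ≤ (M ^ (q.toReal - 2) * ∫⁻ x, ‖f x‖ₑ ^ (2 : ℝ) ∂μ) ^ (1 / q.toReal) := by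
        gcongr
    _ = _ := by
        rw [ENNReal.mul_rpow_of_nonneg _ _ (by positivity), ← ENNReal.rpow_mul, ENNReal.toReal_ofNat,
          ← ENNReal.rpow_mul]
        congr 2 <;> field_simp

/-! ### Sobolev embedding by dyadic decomposition -/

section Embedding

variable {E : Type*} [NormedAddCommGroup E] [InnerProductSpace ℝ E] [FiniteDimensional ℝ E]
  [MeasurableSpace E] [BorelSpace E]

/-- Here G = ⟨ξ⟩^{-s} 𝓕 g. Since s ≥ 0 the weight is bounded by 1, so G stays in L². -/
theorem exists_eq_fourierInv_of_besselPotential_eq {s : ℝ} (hs : 0 ≤ s) {U : 𝓢'(E, ℂ)}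
    {g : Lp ℂ 2 (volume : Measure E)} (hU : TemperedDistribution.besselPotential E ℂ s U = g) :
    ∃ G : Lp ℂ 2 (volume : Measure E), U = (𝓕⁻ G : Lp ℂ 2 (volume : Measure E)) ∧
      ∀ᵐ ξ, ‖G ξ‖ₑ = ENNReal.ofReal ((1 + ‖ξ‖ ^ 2) ^ (-s / 2)) *
        ‖(𝓕 g : Lp ℂ 2 (volume : Measure E)) ξ‖ₑ := by
  have htg : Function.HasTemperateGrowth
      (fun x : E => (((1 + ‖x‖ ^ 2) ^ (-s / 2) : ℝ) : ℂ)) := by fun_prop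
  have hm : MemLp (fun x : E => (((1 + ‖x‖ ^ 2) ^ (-s / 2) : ℝ) : ℂ)) ⊤ volume := by
    refine memLp_top_of_bound htg.1.continuous.aestronglyMeasurable 1 (.of_forall fun x => ?_)
    rw [Complex.norm_real, Real.norm_eq_abs, abs_of_nonneg (by positivity)]
    exact Real.rpow_le_one_of_one_le_of_nonpos (by simp) (by linarith)
  refine ⟨hm.toLp _ • 𝓕 g, ?_, ?_⟩
  · rw [← Lp.fourierInv_toTemperedDistribution_eq, Lp.toTemperedDistribution_smul_eq htg hm,
      ← Lp.fourier_toTemperedDistribution_eq, ← TemperedDistribution.fourierMultiplierCLM_apply]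
    exact ((TemperedDistribution.besselPotential_neg_apply_eq_iff s _ _).2 hU).symm
  · filter_upwards [Lp.coeFn_lpSMul (r := 2) (hm.toLp _) (𝓕 g), hm.coeFn_toLp] with x h1 h2
    rw [h1, Pi.smul_apply', h2, smul_eq_mul, enorm_mul, ← ofReal_norm, Complex.norm_real,
      Real.norm_eq_abs, abs_of_nonneg (by positivity)]

/-- Cauchy–Schwarz against the indicator of `B`. -/
theorem eLpNorm_one_le_of_eq_zero_off {α : Type*} [MeasurableSpace α] {μ : Measure α} {f : α → ℂ}
    {B : Set α} (hf : AEStronglyMeasurable f μ) (hB : MeasurableSet B)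
    (h : ∀ᵐ x ∂μ, x ∉ B → f x = 0) :
    eLpNorm f 1 μ ≤ eLpNorm f 2 μ * μ B ^ (1 / 2 : ℝ) := by
  have h1 : eLpNorm f 1 μ = eLpNorm f 1 (μ.restrict B) := by
    rw [← eLpNorm_indicator_eq_eLpNorm_restrict hB]
    refine eLpNorm_congr_ae ?_
    filter_upwards [h] with x hx
    by_cases hxB : x ∈ B <;> simp [hxB, hx]
  rw [h1]
  refine (eLpNorm_le_eLpNorm_mul_rpow_measure_univ (p := 1) (q := 2) (by norm_num)
    hf.restrict).trans ?_
  rw [Measure.restrict_apply_univ]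
  have h2 : (1 / (1 : ℝ≥0∞).toReal - 1 / (2 : ℝ≥0∞).toReal) = (1 / 2 : ℝ) := by norm_num
  rw [h2]
  gcongr
  exact Measure.restrict_le_self

/-- Bernstein's inequality on a dyadic annulus. -/
theorem eLpNorm_fourierInv_le_of_annulus {s R : ℝ} {q : ℝ≥0∞} (hq : 2 ≤ q) (hs : 0 ≤ s)
    (hR : 1 ≤ R) {H : Lp ℂ 2 (volume : Measure E)} {g : E → ℂ}
    (hH : ∀ᵐ ξ, ¬(R ^ 2 ≤ 1 + ‖ξ‖ ^ 2 ∧ 1 + ‖ξ‖ ^ 2 < (2 * R) ^ 2) → H ξ = 0)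
    (hHg : ∀ᵐ ξ, ‖H ξ‖ₑ ≤ ENNReal.ofReal ((1 + ‖ξ‖ ^ 2) ^ (-s / 2)) * ‖g ξ‖ₑ) :
    eLpNorm (𝓕⁻ H : Lp ℂ 2 (volume : Measure E)) q volume ≤
      (ENNReal.ofReal (2 ^ (Module.finrank ℝ E / 2 : ℝ)) *
        volume (Metric.ball (0 : E) 1) ^ (1 / 2 : ℝ)) ^ (1 - 2 / q.toReal) *
      ENNReal.ofReal (R ^ (Module.finrank ℝ E * (1 / 2 - 1 / q.toReal) - s)) *
        eLpNorm g 2 volume := by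
  have hR0 : 0 < R := by linarith
  set d : ℝ := (Module.finrank ℝ E : ℝ) with hd
  set V := volume (Metric.ball (0 : E) 1)
  have hθ : 0 ≤ 1 - 2 / q.toReal ∧ 0 ≤ 2 / q.toReal := by
    refine ⟨?_, by positivity⟩
    rcases eq_or_ne q ⊤ with rfl | hqt
    · simp
    have hq2 : 2 ≤ q.toReal := by
      have := ENNReal.toReal_mono hqt hq
      simpa using this
    rw [sub_nonneg, div_le_one (by linarith)]; exact hq2
  set a := ENNReal.ofReal (R ^ (-s)) * eLpNorm g 2 volume with ha
  have h2 : eLpNorm H 2 volume ≤ a := by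
    have : eLpNorm H 2 volume ≤ eLpNorm ((R ^ (-s) : ℝ) • g) 2 volume := by
      refine eLpNorm_mono_enorm_ae ?_
      filter_upwards [hH, hHg] with ξ h0 h1
      by_cases hξ : (R ^ 2 ≤ 1 + ‖ξ‖ ^ 2 ∧ 1 + ‖ξ‖ ^ 2 < (2 * R) ^ 2)
      · refine h1.trans ?_
        rw [Pi.smul_apply, enorm_smul, Real.enorm_of_nonneg (by positivity)]
        gcongr
        calc (1 + ‖ξ‖ ^ 2) ^ (-s / 2) ≤ (R ^ 2) ^ (-s / 2) :=
              Real.rpow_le_rpow_of_nonpos (by positivity) hξ.1 (by linarith)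
          _ = R ^ (-s) := by
              rw [← Real.rpow_natCast, ← Real.rpow_mul hR0.le]; congr 1; push_cast; ring
      · rw [h0 hξ]; simp
    refine this.trans ((eLpNorm_const_smul_le (c := (R ^ (-s) : ℝ)) (f := g)).trans (le_of_eq ?_))
    rw [Real.enorm_of_nonneg (by positivity)]
  have hB : MeasurableSet (Metric.ball (0 : E) (2 * R)) := measurableSet_ball
  -- The factor in front of `a` is the square root of the volume (2R)^d V of the ball containing the
  -- annulus.
  have h1 : eLpNorm H 1 volume ≤ (ENNReal.ofReal (2 ^ (d / 2)) * V ^ (1 / 2 : ℝ) *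
      ENNReal.ofReal (R ^ (d / 2))) * a := by
    refine (eLpNorm_one_le_of_eq_zero_off (Lp.memLp H).1 hB ?_).trans ?_
    · filter_upwards [hH] with ξ h0 hξ
      refine h0 fun h => hξ ?_
      rw [mem_ball_zero_iff]
      exact lt_of_pow_lt_pow_left₀ 2 (by positivity) (by linarith [h.2])
    · rw [mul_comm]
      refine mul_le_mul' (le_of_eq ?_) h2
      rw [Measure.addHaar_ball_of_pos _ _ (by positivity), ENNReal.mul_rpow_of_nonneg _ _ (by norm_num),
        ENNReal.ofReal_rpow_of_nonneg (by positivity) (by norm_num),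
        mul_right_comm, ← ENNReal.ofReal_mul (by positivity),
        ← Real.mul_rpow (by norm_num) hR0.le, ← Real.rpow_natCast, ← Real.rpow_mul (by positivity)]
      congr 3
      rw [hd]; ring
  have htop := (eLpNorm_top_fourierInv_le H).trans h1
  have htwo : eLpNorm (𝓕⁻ H : Lp ℂ 2 (volume : Measure E)) 2 volume ≤ a := by
    refine le_trans (le_of_eq ?_) h2
    rw [← Lp.enorm_def, ← Lp.enorm_def, ← ofReal_norm, ← ofReal_norm]
    congr 1
    exact (Lp.fourierTransformₗᵢ E ℂ).symm.norm_map H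
  -- Interpolation between the L^∞ bound and Plancherel: the powers of `a` add up to 1, and R^{d/2}
  -- is raised to 1 - 2/q.
  refine (eLpNorm_le_two_top (Lp.memLp _).1 hq).trans ?_
  refine (mul_le_mul' (ENNReal.rpow_le_rpow htop hθ.1) (ENNReal.rpow_le_rpow htwo hθ.2)).trans ?_
  rw [ENNReal.mul_rpow_of_nonneg _ _ hθ.1, ENNReal.mul_rpow_of_nonneg _ _ hθ.1, mul_assoc,
    ← ENNReal.rpow_add_of_nonneg _ _ hθ.1 hθ.2, sub_add_cancel, ENNReal.rpow_one, ha,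
    ENNReal.ofReal_rpow_of_nonneg (by positivity) hθ.1, ← mul_assoc, mul_assoc (_ ^ _),
    ← ENNReal.ofReal_mul (by positivity), ← Real.rpow_mul hR0.le, ← Real.rpow_add hR0]
  refine le_of_eq ?_
  congr 4
  ring

/-- The Sobolev embedding `H^s ⊆ L^q` for `2 ≤ q ≤ ∞` and `s > n (1/2 - 1/q)`. -/
theorem exists_eLpNorm_le_of_besselPotential_eq {s : ℝ} {q : ℝ≥0∞} (hq : 2 ≤ q) (hs : 0 < s)
    (hsq : Module.finrank ℝ E * (1 / 2 - 1 / q.toReal) < s) :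
    ∃ K : ℝ≥0∞, K ≠ ⊤ ∧ ∀ (U : 𝓢'(E, ℂ)) (g : Lp ℂ 2 (volume : Measure E)),
      TemperedDistribution.besselPotential E ℂ s U = g →
      ∃ h : Lp ℂ 2 (volume : Measure E), U = h ∧ eLpNorm h q volume ≤ K * ‖g‖ₑ := by
  set σ : ℝ := Module.finrank ℝ E * (1 / 2 - 1 / q.toReal) - s with hσ
  set C : ℝ≥0∞ := (ENNReal.ofReal (2 ^ (Module.finrank ℝ E / 2 : ℝ)) *
        volume (Metric.ball (0 : E) 1) ^ (1 / 2 : ℝ)) ^ (1 - 2 / q.toReal) with hC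
  have hCtop : C ≠ ⊤ := by
    refine ENNReal.rpow_ne_top_of_ne_zero ?_ ?_
    · refine mul_ne_zero (by simp; positivity) ?_
      have h0 := (Metric.measure_ball_pos volume (0 : E) one_pos).ne'
      simp [h0]
    · exact ENNReal.mul_ne_top ENNReal.ofReal_ne_top
        (ENNReal.rpow_ne_top_of_nonneg (by norm_num) measure_ball_lt_top.ne)
  -- Ratio of the geometric series: Bernstein with R = 2^N contributes 2^{Nσ}, and σ < 0.
  set ρ : ℝ≥0∞ := ENNReal.ofReal (2 ^ σ) with hρ
  have hρ1 : ρ < 1 := by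
    rw [hρ, ENNReal.ofReal_lt_one]
    exact Real.rpow_lt_one_of_one_lt_of_neg (by norm_num) (by linarith)
  refine ⟨C * (1 - ρ)⁻¹, ENNReal.mul_ne_top hCtop ?_, fun U g hU => ?_⟩
  · exact ENNReal.inv_ne_top.2 (tsub_pos_of_lt hρ1).ne'
  obtain ⟨G, rfl, hG⟩ := exists_eq_fourierInv_of_besselPotential_eq hs.le hU
  refine ⟨𝓕⁻ G, rfl, ?_⟩
  set γ : Lp ℂ 2 (volume : Measure E) := 𝓕 g with hγ
  have hγn : eLpNorm γ 2 volume = ‖g‖ₑ := by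
    rw [← Lp.enorm_def, ← ofReal_norm, ← ofReal_norm, hγ, Lp.norm_fourier_eq]
  -- The regions ⟨ξ⟩ < 2^N. As ⟨ξ⟩ ≥ 1, `A 0` is empty, so the telescoping sum has no low-frequency
  -- remainder.
  let A : ℕ → Set E := fun N => {ξ | 1 + ‖ξ‖ ^ 2 < ((2 : ℝ) ^ N) ^ 2}
  have hA : ∀ N, MeasurableSet (A N) := fun N =>
    (isOpen_lt (by fun_prop) continuous_const).measurableSet
  let S : ℕ → Lp ℂ 2 (volume : Measure E) := fun N => ((Lp.memLp G).indicator (hA N)).toLp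
  have hS : ∀ N, S N =ᵐ[volume] (A N).indicator G := fun N => MemLp.coeFn_toLp _
  have hstep : ∀ N, eLpNorm (𝓕⁻ (S (N + 1) - S N) : Lp ℂ 2 (volume : Measure E)) q volume ≤
      C * ρ ^ N * ‖g‖ₑ := by
    intro N
    have hval : ∀ᵐ ξ, (S (N + 1) - S N : Lp ℂ 2 (volume : Measure E)) ξ =
        (A (N + 1)).indicator G ξ - (A N).indicator G ξ := by
      filter_upwards [Lp.coeFn_sub (S (N + 1)) (S N), hS N, hS (N + 1)] with ξ h1 h2 h3
      rw [h1, Pi.sub_apply, h2, h3]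
    have hmono : A N ⊆ A (N + 1) := fun ξ hξ => by
      have hξ' : 1 + ‖ξ‖ ^ 2 < ((2 : ℝ) ^ N) ^ 2 := hξ
      exact hξ'.trans_le (by gcongr <;> simp)
    have key := eLpNorm_fourierInv_le_of_annulus (s := s) (R := 2 ^ N) hq hs.le
      (one_le_pow₀ (by norm_num)) (H := S (N + 1) - S N) (g := γ) ?_ ?_
    · rw [hγn] at key
      refine key.trans (le_of_eq ?_)
      congr 2
      rw [hρ, ← ENNReal.ofReal_pow (by positivity), ← Real.rpow_natCast, ← Real.rpow_natCast,
        ← Real.rpow_mul (by norm_num), ← Real.rpow_mul (by norm_num), mul_comm]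
    · filter_upwards [hval] with ξ h hξ
      rw [h]
      by_cases h1 : ξ ∈ A N
      · simp [h1, hmono h1]
      · have h2 : ξ ∉ A (N + 1) := fun h2 => hξ ⟨not_lt.1 h1, by
          have : 1 + ‖ξ‖ ^ 2 < ((2 : ℝ) ^ (N + 1)) ^ 2 := h2
          rwa [pow_succ' 2 N] at this⟩
        simp [h1, h2]
    · filter_upwards [hval, hG] with ξ h hGξ
      rw [h, ← hGξ]
      by_cases h1 : ξ ∈ A N
      · simp [h1, hmono h1]
      · by_cases h2 : ξ ∈ A (N + 1) <;> simp [h1, h2]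
  have hS0 : S 0 = 0 := by
    refine Lp.ext ?_
    filter_upwards [hS 0, Lp.coeFn_zero ℂ 2 (volume : Measure E)] with ξ h1 h2
    have : ξ ∉ A 0 := fun h => by
      have h : 1 + ‖ξ‖ ^ 2 < ((2 : ℝ) ^ 0) ^ 2 := h
      simp only [pow_zero, one_pow] at h
      nlinarith [sq_nonneg ‖ξ‖]
    rw [h1, h2]
    simp [this]
  have hbound : ∀ N, eLpNorm (𝓕⁻ (S N) : Lp ℂ 2 (volume : Measure E)) q volume ≤
      C * (∑ k ∈ Finset.range N, ρ ^ k) * ‖g‖ₑ := by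
    intro N
    induction N with
    | zero =>
      rw [hS0, FourierTransform.fourierInv_zero,
        eLpNorm_congr_ae (Lp.coeFn_zero ℂ 2 (volume : Measure E))]
      simp
    | succ N ih =>
      have h1 : (𝓕⁻ (S (N + 1)) : Lp ℂ 2 (volume : Measure E)) =
          𝓕⁻ (S N) + 𝓕⁻ (S (N + 1) - S N) := by
        rw [← FourierTransform.fourierInv_add]; simp
      rw [h1, eLpNorm_congr_ae (Lp.coeFn_add _ _)]
      refine (eLpNorm_add_le (Lp.memLp _).1 (Lp.memLp _).1
        (le_trans (by norm_num) hq)).trans ?_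
      rw [Finset.sum_range_succ, mul_add, add_mul]
      exact add_le_add ih (hstep N)
  have hbound' : ∀ N, eLpNorm (𝓕⁻ (S N) : Lp ℂ 2 (volume : Measure E)) q volume ≤
      C * (1 - ρ)⁻¹ * ‖g‖ₑ := by
    intro N
    refine (hbound N).trans ?_
    rw [← ENNReal.tsum_geometric]
    gcongr
    exact ENNReal.sum_le_tsum _
  -- Off `A N` the weight ⟨ξ⟩^{-s} is at most 2^{-Ns}, which tends to 0 because s > 0.
  have hlim : Tendsto S atTop (𝓝 G) := by
    rw [tendsto_iff_norm_sub_tendsto_zero]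
    have hr : (2 : ℝ) ^ (-s) < 1 := Real.rpow_lt_one_of_one_lt_of_neg (by norm_num) (by linarith)
    have h0 := (tendsto_pow_atTop_nhds_zero_of_lt_one (by positivity) hr).mul_const ‖γ‖
    rw [zero_mul] at h0
    refine squeeze_zero (fun _ => norm_nonneg _) (fun N => ?_) h0
    refine Lp.norm_le_mul_norm_of_ae_le_mul ?_
    filter_upwards [Lp.coeFn_sub (S N) G, hS N, hG] with ξ h1 h2 h3
    rw [h1, Pi.sub_apply, h2]
    by_cases h : ξ ∈ A N
    · simp only [h, Set.indicator_of_mem, sub_self, norm_zero]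
      positivity
    · have h' : ((2 : ℝ) ^ N) ^ 2 ≤ 1 + ‖ξ‖ ^ 2 := not_lt.1 h
      rw [Set.indicator_of_notMem h, zero_sub, norm_neg, ← toReal_enorm, h3, ENNReal.toReal_mul,
        ENNReal.toReal_ofReal (by positivity), toReal_enorm]
      gcongr
      calc (1 + ‖ξ‖ ^ 2) ^ (-s / 2) ≤ (((2 : ℝ) ^ N) ^ 2) ^ (-s / 2) :=
            Real.rpow_le_rpow_of_nonpos (by positivity) h' (by linarith)
        _ = _ := by
            rw [← pow_mul, ← Real.rpow_natCast, ← Real.rpow_natCast, ← Real.rpow_mul (by norm_num),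
              ← Real.rpow_mul (by norm_num)]
            congr 1; push_cast; ring
  have hlim' : Tendsto (fun N => (𝓕⁻ (S N) : Lp ℂ 2 (volume : Measure E))) atTop (𝓝 (𝓕⁻ G)) :=
    ((Lp.fourierTransformₗᵢ E ℂ).symm.continuous.tendsto G).comp hlim
  -- L² convergence gives an a.e. convergent subsequence, and Fatou carries the uniform L^q bound to
  -- the limit.
  obtain ⟨ns, -, hns⟩ := (tendstoInMeasure_of_tendsto_Lp hlim').exists_seq_tendsto_ae
  refine (Lp.eLpNorm_lim_le_liminf_eLpNorm (fun k => (Lp.memLp _).1) _ hns).trans ?_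
  exact liminf_le_of_le (by isBoundedDefault) fun b hb =>
    let ⟨k, hk⟩ := hb.exists
    hk.trans (hbound' _)

end Embedding

/-! ### Multiplier norms of L^p functions -/

namespace SobolevMultipliers

variable {n : ℕ}

theorem exists_besselPotential_eq_of_sobolevNorm_lt {r : ℝ} {U : 𝓢'(Rn n, ℂ)} {c : ℝ≥0∞}
    (h : sobolevNorm r U < c) :
    ∃ g : Lp ℂ 2 (volume : Measure (Rn n)),
      TemperedDistribution.besselPotential (Rn n) ℂ r U = g ∧ ‖g‖ₑ < c := by
  simpa only [sobolevNorm, iInf_lt_iff, exists_prop] using h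

/-- L² embeds injectively into tempered distributions. -/
theorem ae_eq_of_testToTempered_eq {Ω : Opens (Rn n)} {v : 𝓓(Ω, ℂ)}
    {h : Lp ℂ 2 (volume : Measure (Rn n))} (hv : testToTempered v = (h : 𝓢'(Rn n, ℂ))) :
    v =ᵐ[volume] h := by
  have h1 : Lp.toTemperedDistributionCLM ℂ volume 2 ((toSchwartz v).toLp 2 volume) =
      Lp.toTemperedDistributionCLM ℂ volume 2 h := by
    rw [Lp.toTemperedDistributionCLM_apply, Lp.toTemperedDistributionCLM_apply, ← hv,
      Lp.toTemperedDistribution_toLp_eq]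
    rfl
  have h2 := LinearMap.ker_eq_bot.1 (Lp.ker_toTemperedDistributionCLM_eq_bot
    (F := ℂ) (μ := (volume : Measure (Rn n))) (p := 2)) h1
  have h3 := (toSchwartz v).coeFn_toLp 2 (volume : Measure (Rn n))
  rw [h2] at h3
  exact h3.symm

theorem ofFun_apply {Ω : Opens (Rn n)} {g : Rn n → ℂ}
    (hg : LocallyIntegrableOn g (Ω : Set (Rn n)) volume) (φ : 𝓓(Ω, ℂ)) :
    ofFun Ω g φ = ∫ x, φ x * g x :=
  TestFunction.integralAgainstBilinCLM_eq_integral hg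

theorem locallyIntegrableOn_of_memLp {g : Rn n → ℂ} {p : ℝ≥0∞} (hp : 1 ≤ p)
    (hg : MemLp g p volume) (s : Set (Rn n)) : LocallyIntegrableOn g s volume :=
  (hg.locallyIntegrable hp).locallyIntegrableOn s

theorem ofFun_sub {Ω : Opens (Rn n)} {f g : Rn n → ℂ}
    (hf : LocallyIntegrableOn f (Ω : Set (Rn n)) volume)
    (hg : LocallyIntegrableOn g (Ω : Set (Rn n)) volume) :
    ofFun Ω f - ofFun Ω g = ofFun Ω (f - g) := by
  have key : ∀ {k : Rn n → ℂ} (_ : LocallyIntegrableOn k (Ω : Set (Rn n)) volume) (φ : 𝓓(Ω, ℂ)),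
      Integrable (fun x => φ x * k x) := fun {k} hk φ => by
    have h1 := (hk.integrableOn_compact_subset φ.tsupport_subset φ.hasCompactSupport)
    have h2 : IntegrableOn (fun x => φ x * k x) (tsupport φ) volume :=
      h1.continuousOn_mul φ.contDiff.continuous.continuousOn φ.hasCompactSupport
    refine (integrableOn_iff_integrable_of_support_subset ?_).1 h2
    exact (Function.support_mul_subset_left _ _).trans (subset_tsupport _)
  ext φ
  rw [sub_apply, ofFun_apply hf, ofFun_apply hg, ofFun_apply (hf.sub hg),
    ← integral_sub (key hf φ) (key hg φ)]
  simp only [Pi.sub_apply, mul_sub]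

theorem restrict_toTemperedDistribution (Ω : Opens (Rn n)) {p : ℝ≥0∞} [hp : Fact (1 ≤ p)]
    (h : Lp ℂ p (volume : Measure (Rn n))) :
    restrict Ω (h : 𝓢'(Rn n, ℂ)) = ofFun Ω h := by
  ext φ
  rw [ofFun_apply (locallyIntegrableOn_of_memLp hp.out (Lp.memLp h) _)]
  change (h : 𝓢'(Rn n, ℂ)) (toSchwartz φ) = _
  rw [Lp.toTemperedDistribution_apply]
  rfl

/-- Multiplication by an `L^p` function, `p ≥ 2`, `p > n/t`, maps `H^t` to `L²`. -/
theorem exists_multiplierNorm_ofFun_le {t : ℝ} (ht : 0 < t) {p : ℝ≥0∞} (hp : 2 ≤ p)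
    (hp' : p ≠ ⊤) (hpt : (n : ℝ) / t < p.toReal) :
    ∃ K : ℝ≥0∞, K ≠ ⊤ ∧ ∀ f : Rn n → ℂ, MemLp f p volume →
      multiplierNorm 0 (-t) (ofFun ⊤ f) ≤ K * eLpNorm f p volume := by
  -- The Hölder exponent 1/q = 1/2 - 1/p; for p = 2 it is ∞.
  set q : ℝ≥0∞ := (2⁻¹ - p⁻¹)⁻¹ with hq
  have hple : p⁻¹ ≤ 2⁻¹ := ENNReal.inv_le_inv.2 hp
  have hp0 : p ≠ 0 := fun h => by simp [h] at hp
  have hinv : q⁻¹ = 2⁻¹ - p⁻¹ := by rw [hq, inv_inv]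
  have hq2 : 2 ≤ q := by
    rw [← ENNReal.inv_le_inv, hinv]; exact tsub_le_self
  have : ENNReal.HolderTriple q p 2 := ⟨by rw [hinv]; exact tsub_add_cancel_of_le hple⟩
  have : ENNReal.HolderTriple 2 2 1 := ⟨by rw [ENNReal.inv_two_add_inv_two, inv_one]⟩
  have hpr : 0 < p.toReal := ENNReal.toReal_pos hp0 hp'
  have hqr : 1 / q.toReal = 1 / 2 - 1 / p.toReal := by
    rw [one_div, ← ENNReal.toReal_inv, hinv,
      ENNReal.toReal_sub_of_le hple (by simp), ENNReal.toReal_inv, ENNReal.toReal_inv]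
    simp
  obtain ⟨K, hK, hemb⟩ := exists_eLpNorm_le_of_besselPotential_eq (E := Rn n) hq2 ht (by
    rw [hqr, finrank_euclideanSpace_fin]
    rw [div_lt_iff₀ ht] at hpt
    have : (n : ℝ) / p.toReal < t := by rw [div_lt_iff₀ hpr]; linarith
    calc (n : ℝ) * (1 / 2 - (1 / 2 - 1 / p.toReal)) = n / p.toReal := by ring
      _ < t := this)
  -- `sobolevNorm` is an infimum, so a norm equal to 1 is used only through a representative of norm
  -- < 2; hence one factor 2 each for `u` and `v`.
  refine ⟨2 * (K * 2), by finiteness, fun f hf => ?_⟩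
  refine iSup_le fun u => iSup_le fun v => iSup_le fun hu => iSup_le fun hv => ?_
  rw [neg_neg] at hv
  obtain ⟨g, hg, hgn⟩ := exists_besselPotential_eq_of_sobolevNorm_lt
    (hu.trans_lt (by norm_num : (1 : ℝ≥0∞) < 2))
  rw [TemperedDistribution.besselPotential_zero, ContinuousLinearMap.id_apply] at hg
  obtain ⟨w, hw, hwn⟩ := exists_besselPotential_eq_of_sobolevNorm_lt
    (hv.trans_lt (by norm_num : (1 : ℝ≥0∞) < 2))
  obtain ⟨h, hh, hhn⟩ := hemb _ _ hw
  have hu2 : eLpNorm u 2 volume ≤ 2 := by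
    rw [eLpNorm_congr_ae (ae_eq_of_testToTempered_eq hg), ← Lp.enorm_def]
    exact hgn.le
  have hvq : eLpNorm v q volume ≤ K * 2 := by
    rw [eLpNorm_congr_ae (ae_eq_of_testToTempered_eq hh)]
    exact hhn.trans (mul_le_mul_right hwn.le _)
  rw [ofFun_apply (locallyIntegrableOn_of_memLp (le_trans (by norm_num) hp) hf _)]
  have hum : AEStronglyMeasurable u volume := u.contDiff.continuous.aestronglyMeasurable
  have hvm : AEStronglyMeasurable v volume := v.contDiff.continuous.aestronglyMeasurable
  have e1 : ∀ x, testMul u v x * f x = (⇑u • ⇑v • f) x := fun x => mul_assoc _ _ _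
  simp only [e1]
  refine (enorm_integral_le_lintegral_enorm _).trans ?_
  rw [← eLpNorm_one_eq_lintegral_enorm]
  calc eLpNorm (⇑u • ⇑v • f) 1 volume
      ≤ eLpNorm u 2 volume * eLpNorm (⇑v • f) 2 volume :=
        eLpNorm_smul_le_mul_eLpNorm (hvm.smul hf.1) hum
    _ ≤ 2 * (eLpNorm v q volume * eLpNorm f p volume) :=
        mul_le_mul' hu2 (eLpNorm_smul_le_mul_eLpNorm hf.1 hvm)
    _ ≤ 2 * ((K * 2) * eLpNorm f p volume) := by gcongr
    _ = _ := by ring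

/-- The L^p norm dominates the multiplier norm, so L^p approximation by C_c^∞ suffices. -/
theorem ofFun_mem_multipliersZero {t : ℝ} (ht : 0 < t) {p : ℝ≥0∞} (hp : 2 ≤ p)
    (hp' : p ≠ ⊤) (hpt : (n : ℝ) / t < p.toReal) {f : Rn n → ℂ} (hf : MemLp f p volume) :
    ofFun ⊤ f ∈ multipliersZero n 0 (-t) := by
  obtain ⟨K, hK, hmul⟩ := exists_multiplierNorm_ofFun_le ht hp hp' hpt
  have hp1 : 1 ≤ p := le_trans (by norm_num) hp
  refine ⟨(hmul f hf).trans_lt (ENNReal.mul_lt_top hK.lt_top hf.2), fun ε hε => ?_⟩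
  obtain ⟨δ, hδ, hδε⟩ : ∃ δ : ℝ, 0 < δ ∧ K * ENNReal.ofReal δ < ε := by
    obtain ⟨δ, hδ, hδε⟩ := ENNReal.exists_nnreal_pos_mul_lt hK hε.ne'
    refine ⟨δ, hδ, ?_⟩
    rw [ENNReal.ofReal_coe_nnreal, mul_comm]
    exact hδε
  obtain ⟨g, hgc, hgd, hgn⟩ := hf.exist_eLpNorm_sub_le hp' hp1 hδ
  let φ : 𝓓((⊤ : Opens (Rn n)), ℂ) := ⟨g, hgd, hgc, by simp⟩
  have hg : MemLp g p volume := hgd.continuous.memLp_of_hasCompactSupport hgc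
  refine ⟨φ, ?_⟩
  change multiplierNorm 0 (-t) (ofFun ⊤ f - ofFun ⊤ g) < ε
  rw [ofFun_sub (locallyIntegrableOn_of_memLp hp1 hf _) (locallyIntegrableOn_of_memLp hp1 hg _)]
  exact (hmul _ (hf.sub hg)).trans_lt ((mul_le_mul_right hgn _).trans_lt hδε)

/-- If `r ≥ 0` and `r > n/2 - t`, then `H^r ⊆ L^p` for some finite `p ≥ 2` with `p > n/t`. -/
theorem exists_memLp_of_memSobolev (hn : 1 ≤ n) {t r : ℝ} (ht : 0 < t) (hr : 0 ≤ r)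
    (hrt : (n : ℝ) / 2 - t < r) :
    ∃ p : ℝ≥0∞, 2 ≤ p ∧ p ≠ ⊤ ∧ (n : ℝ) / t < p.toReal ∧
      ∀ U : 𝓢'(Rn n, ℂ), TemperedDistribution.MemSobolev r 2 U →
        ∃ h : Lp ℂ 2 (volume : Measure (Rn n)), U = h ∧ MemLp h p volume := by
  have hn0 : (0 : ℝ) < n := by exact_mod_cast hn
  -- The embedding lemma needs a positive order. For r = 0, p = 2 works, since then n/2 < t.
  rcases hr.eq_or_lt with rfl | hr
  · refine ⟨2, le_rfl, by norm_num, ?_, fun U hU => ?_⟩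
    · rw [ENNReal.toReal_ofNat, div_lt_iff₀ ht]; linarith
    · obtain ⟨h, hh⟩ := TemperedDistribution.memSobolev_zero_iff.1 hU
      exact ⟨h, hh, Lp.memLp h⟩
  -- Here a = 1/p: a > 0 makes p finite, a > 1/2 - r/n gives the embedding, a < 1/2 gives p > 2, and
  -- a < t/n gives p > n/t. The condition r > n/2 - t is exactly 1/2 - r/n < t/n.
  · obtain ⟨a, ha1, ha2⟩ : ∃ a : ℝ, max 0 (1 / 2 - r / n) < a ∧ a < min (1 / 2) (t / n) := by
      refine exists_between (max_lt (lt_min (by norm_num) (by positivity))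
        (lt_min (by linarith [div_pos hr hn0]) ?_))
      rw [lt_div_iff₀ hn0, sub_mul, div_mul_cancel₀ _ hn0.ne']
      linarith
    obtain ⟨ha0, ha1⟩ := max_lt_iff.1 ha1
    obtain ⟨ha2, ha3⟩ := lt_min_iff.1 ha2
    have htr : (ENNReal.ofReal a⁻¹).toReal = a⁻¹ := ENNReal.toReal_ofReal (by positivity)
    have hp2 : 2 ≤ ENNReal.ofReal a⁻¹ := by
      rw [ENNReal.le_ofReal_iff_toReal_le (by norm_num) (by positivity), ENNReal.toReal_ofNat,
        le_inv_comm₀ (by norm_num) ha0]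
      linarith
    refine ⟨ENNReal.ofReal a⁻¹, hp2, ENNReal.ofReal_ne_top, ?_, fun U hU => ?_⟩
    · rw [htr, lt_inv_comm₀ (by positivity) ha0, inv_div]
      exact ha3
    · obtain ⟨g, hg⟩ := hU
      obtain ⟨K, hK, hemb⟩ := exists_eLpNorm_le_of_besselPotential_eq (E := Rn n) hp2 hr (by
        rw [htr, finrank_euclideanSpace_fin, one_div a⁻¹, inv_inv]
        rw [sub_lt_comm, lt_div_iff₀ hn0] at ha1
        linarith)
      obtain ⟨h, hh, hhn⟩ := hemb U g hg
      exact ⟨h, hh, (Lp.memLp h).1, hhn.trans_lt (ENNReal.mul_lt_top hK.lt_top enorm_lt_top)⟩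

end SobolevMultipliers

end

/-! ### The proposition -/

theorem proposition1p4 (n : ℕ) (hn : 1 ≤ n) (Ω : Opens (Rn n)) (t : ℝ) (ht : 0 < t) :
    -- `L^p(Ω)`, through extension by zero
    (∀ p : ℝ≥0∞, 2 ≤ p → p ≠ ⊤ → (n : ℝ) / t < p.toReal →
      ∀ f : Rn n → ℂ, MemLp f p (volume.restrict (Ω : Set (Rn n))) →
        ofFun ⊤ ((Ω : Set (Rn n)).indicator f) ∈ multipliersZero n 0 (-t)) ∧
    -- `L^∞(Ω)` for bounded `Ω`
    (Bornology.IsBounded (Ω : Set (Rn n)) →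
      ∀ f : Rn n → ℂ, MemLp f ⊤ (volume.restrict (Ω : Set (Rn n))) →
        ofFun ⊤ ((Ω : Set (Rn n)).indicator f) ∈ multipliersZero n 0 (-t)) ∧
    (∀ r : ℝ, 0 ≤ r → (n : ℝ) / 2 - t < r →
      (∀ U ∈ tildeSobolev r Ω, restrict ⊤ U ∈ multipliersZero n 0 (-t)) ∧
      (IsLipschitzDomain Ω → ∀ U ∈ sobolevSupportedIn r (closure (Ω : Set (Rn n))),
        restrict ⊤ U ∈ multipliersZero n 0 (-t)) ∧
      -- each `w ∈ H^r_0(Ω)` is a function in `L²(Ω)`, and its extension by zero is a multiplier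
      (IsLipschitzDomain Ω → (∀ k : ℕ, r ≠ k + 1 / 2) → ∀ w ∈ sobolevZero r Ω,
        ∃ g : Rn n → ℂ, MemLp g 2 (volume.restrict (Ω : Set (Rn n))) ∧ w = ofFun Ω g ∧
          ofFun ⊤ ((Ω : Set (Rn n)).indicator g) ∈ multipliersZero n 0 (-t))) := by
  have hΩ : MeasurableSet (Ω : Set (Rn n)) := Ω.isOpen.measurableSet
  have hLp : ∀ p : ℝ≥0∞, 2 ≤ p → p ≠ ⊤ → (n : ℝ) / t < p.toReal →
      ∀ f : Rn n → ℂ, MemLp f p (volume.restrict (Ω : Set (Rn n))) →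
        ofFun ⊤ ((Ω : Set (Rn n)).indicator f) ∈ multipliersZero n 0 (-t) :=
    fun p hp hp' hpt f hf =>
      ofFun_mem_multipliersZero ht hp hp' hpt ((memLp_indicator_iff_restrict hΩ).2 hf)
  refine ⟨hLp, fun hb f hf => ?_, fun r hr hrt => ?_⟩
  · have : IsFiniteMeasure (volume.restrict (Ω : Set (Rn n))) :=
      ⟨by rw [Measure.restrict_apply_univ]; exact hb.measure_lt_top⟩
    -- Any finite admissible exponent serves, as L^∞ ⊆ L^p on a set of finite measure; 2 + n/t meets
    -- both lower bounds.
    refine hLp (ENNReal.ofReal (2 + n / t)) ?_ ENNReal.ofReal_ne_top ?_ f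
      (hf.mono_exponent le_top)
    · rw [ENNReal.le_ofReal_iff_toReal_le (by norm_num) (by positivity), ENNReal.toReal_ofNat]
      linarith [show 0 ≤ (n : ℝ) / t by positivity]
    · rw [ENNReal.toReal_ofReal (by positivity)]
      linarith
  · obtain ⟨p, hp, hp', hpt, hemb⟩ := exists_memLp_of_memSobolev hn ht hr hrt
    have hmem : ∀ U : 𝓢'(Rn n, ℂ), TemperedDistribution.MemSobolev r 2 U →
        restrict ⊤ U ∈ multipliersZero n 0 (-t) := fun U hU => by
      obtain ⟨h, rfl, hh⟩ := hemb U hU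
      rw [restrict_toTemperedDistribution]
      exact ofFun_mem_multipliersZero ht hp hp' hpt hh
    refine ⟨fun U hU => hmem U hU.1, fun _ U hU => hmem U hU.1, fun _ _ w hw => ?_⟩
    obtain ⟨U, rfl, hU⟩ : ∃ U : 𝓢'(Rn n, ℂ), restrict Ω U = w ∧ sobolevNorm r U < ⊤ := by
      simpa only [localSobolevNorm, iInf_lt_iff, exists_prop] using hw.1
    obtain ⟨g, hg, -⟩ := exists_besselPotential_eq_of_sobolevNorm_lt hU
    -- The extension `h` lies in L² ∩ L^p: L² gives the representing function on Ω, L^p reduces its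
    -- extension by zero to (i).
    obtain ⟨h, rfl, hh⟩ := hemb U ⟨g, hg⟩
    exact ⟨h, (Lp.memLp h).restrict _, restrict_toTemperedDistribution Ω h,
      hLp p hp hp' hpt h (hh.restrict _)⟩
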